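/- Let $l,w\ge 1$ be integers, $n=lw$ and $c\in\{0,1\}$. The hammock network $H^{c}_{(l,w)}$ of length $l$ and width $w$ is the two-terminal network obtained from $w$ parallel rows, each consisting of $l$ edges in series, with junction points $(j,i)$, $0\le j\le l$, $0\le i<w$ ($j$ is the position in row $i$), by identifying all left ends $(0,i)$ to one terminal, all right ends $(l,i)$ to the other terminal, and, for $0<j<l$ and $0\le i<w-1$, the points $(j,i)$ and $(j,i+1)$ exactly when $i+j\equiv c \pmod 2$ (brick-wall pattern). It has $n$ edges. Its reliability polynomial $h(p)$, $p\in[0,1]$, is the probability that the two terminals are connected by closed edges when each edge is closed independently with probability $p$. Networks $H^{c}_{(l,w)}$ and $H^{c'}_{(w,l)}$ are called dual hammocks if $l$ or $w$ is odd ($c,c'$ arbitrary; the two patterns then give isomorphic networks), or if $l$ and $w$ are both even and $c'\ne c$. Let $H^{c}_{(l,w)}$ and $H^{c'}_{(w,l)}$ be dual hammocks, and write their reliability polynomials in N-form: $$h_{(l,w)}(p)=\sum_{k=0}^{n}N_k\,p^k(1-p)^{n-k},\qquad h_{(w,l)}(p)=\sum_{k=0}^{n}N_k^{\perp}\,p^k(1-p)^{n-k}\qquad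 (p\in[0,1]),$$ with real coefficients $N_k$, $N_k^{\perp}$. Then $$N_k+N_{n-k}^{\perp}=\binom{n}{k}\qquad\text{for all }k\in\{0,1,\dots,n\}.$$ -/

import Mathlib

/-- A two-terminal network: a multigraph with vertex type `V` whose edges (the devices, or contacts)
are labelled by `E`, together with two distinguished vertices, the terminals. -/
structure TwoTerminalNetwork (V E : Type*) where
  /-- one end of an edge -/
  src : E → V
  /-- the other end of an edge -/
  tgt : E → V
  /-- first terminal -/
  s : V
  /-- second terminal -/
  t : V

namespace TwoTerminalNetwork

variable {V E : Type*}

/-- The (undirected) graph formed by the edges of the network that lie in `A`. -/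
def closedGraph (G : TwoTerminalNetwork V E) (A : Finset E) : SimpleGraph V :=
  SimpleGraph.fromRel fun u v => ∃ e ∈ A, G.src e = u ∧ G.tgt e = v

/-- When exactly the edges in `A` are closed, the two terminals are connected. -/
def Conducts (G : TwoTerminalNetwork V E) (A : Finset E) : Prop :=
  (G.closedGraph A).Reachable G.s G.t

open Classical in
/-- The reliability polynomial: the probability that the two terminals are connected when every
edge is closed with probability `p`, independently of the others. -/
noncomputable def reliability [Fintype E] (G : TwoTerminalNetwork V E) (p : ℝ) : ℝ :=
  ∑ A : Finset E with G.Conducts A, ∏ e : E, if e ∈ A then p else 1 - p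

end TwoTerminalNetwork

/-- The identifications that turn `w` parallel rows of `l` contacts in series into a hammock.
The point `(j, i)` is the `j`-th junction point (`0 ≤ j ≤ l`) of row `i` (`0 ≤ i < w`).
All left ends are identified, all right ends are identified, and at the inner junctions `0 < j < l`
vertically neighbouring points are identified in a brick-wall pattern: those between the rows
`i` and `i + 1` exactly when `i + j` has parity `c`. -/
inductive HammockTie (l w : ℕ) (c : Fin 2) : Fin (l + 1) × Fin w → Fin (l + 1) × Fin w → Prop
  | left (i i' : Fin w) : HammockTie l w c (0, i) (0, i')
  | right (i i' : Fin w) : HammockTie l w c (Fin.last l, i) (Fin.last l, i')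
  | brick (j : Fin (l + 1)) (i i' : Fin w) (hj : 0 < (j : ℕ)) (hjl : (j : ℕ) < l)
      (hi : (i' : ℕ) = i + 1) (hc : ((i : ℕ) + j) % 2 = c) : HammockTie l w c (j, i) (j, i')

/-- The vertices of a hammock: junction points up to the equivalence generated by the ties. -/
abbrev HammockVertex (l w : ℕ) (c : Fin 2) : Type := Quot (HammockTie l w c)

/-- The hammock network of length `l` and width `w` with brick-wall pattern `c`. Its `l * w` edges
are the contacts `(j, i)`, joining the junction points `j` and `j + 1` of row `i`; its terminals
are the common left end and the common right end of the rows. -/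
def hammock (l w : ℕ) [NeZero w] (c : Fin 2) :
    TwoTerminalNetwork (HammockVertex l w c) (Fin l × Fin w) where
  src e := Quot.mk _ (e.1.castSucc, e.2)
  tgt e := Quot.mk _ (e.1.succ, e.2)
  s := Quot.mk _ (0, 0)
  t := Quot.mk _ (Fin.last l, 0)

/-- `N 0, …, N n` are the coefficients of the N-form of `h`, that is,
`h p = ∑ k ≤ n, N k * p ^ k * (1 - p) ^ (n - k)` on `[0, 1]`. -/
def IsNForm (n : ℕ) (h : ℝ → ℝ) (N : ℕ → ℝ) : Prop :=
  ∀ p ∈ Set.Icc (0 : ℝ) 1, h p = ∑ k ∈ Finset.range (n + 1), N k * p ^ k * (1 - p) ^ (n - k)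

open Classical in
/-- Every reliability polynomial has an N-form, with non-negative coefficients. -/
theorem TwoTerminalNetwork.exists_isNForm {V E : Type*} [Fintype E] (G : TwoTerminalNetwork V E) :
    ∃ N : ℕ → ℝ, (∀ k, 0 ≤ N k) ∧ IsNForm (Fintype.card E) G.reliability N := by
  refine ⟨fun k => (Finset.card {A : Finset E | G.Conducts A ∧ A.card = k} : ℝ),
    fun k => Nat.cast_nonneg _, fun p _ => ?_⟩
  have hprod : ∀ A : Finset E, (∏ e : E, if e ∈ A then p else 1 - p)
      = p ^ A.card * (1 - p) ^ (Fintype.card E - A.card) := by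
    intro A
    rw [Finset.prod_ite, Finset.prod_const, Finset.prod_const]
    congr 2
    · simp
    · rw [← Finset.card_compl]
      congr 1
      ext e
      simp
  unfold TwoTerminalNetwork.reliability
  simp only [hprod]
  rw [← Finset.sum_fiberwise_of_maps_to (s := Finset.univ.filter fun A => G.Conducts A)
    (t := Finset.range (Fintype.card E + 1)) (g := Finset.card)
    (fun A _ => Finset.mem_range_succ_iff.2 (Finset.card_le_univ A))]
  refine Finset.sum_congr rfl fun k _ => ?_
  rw [Finset.filter_filter, mul_assoc, ← nsmul_eq_mul, ← Finset.sum_const]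
  refine Finset.sum_congr rfl fun A hA => ?_
  rw [(Finset.mem_filter.1 hA).2.2]

/-!
The hammock `H^c_(l,w)` and the hammock `H^c'_(w,l)` with `c' ≠ c` are planar duals of each other:
the contact `(j, i)` of the former crosses the contact `(i, j)` of the latter. The heart of the
matter is that a set `A` of closed contacts connects the terminals of the first network exactly
when the complementary set of contacts does not connect the terminals of the second one
(`hammock_conducts_iff_not_conducts`). The topological content of this statement is replaced by
linear algebra over `ℤ`.

* The terminals are disconnected if and only if there is a *potential*: a function on the vertices
  that is constant along closed edges and separates the terminals (`not_conducts_iff`). If they are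
  connected, there is a unit flow through the closed edges (`Conducts.exists_flow`).
* At least one of the two networks conducts: for functions `f` and `g` on the vertices of the two
  hammocks, `∑ (f (j + 1, i) - f (j, i)) * (g (i + 1, j) - g (i, j))` is the product of the
  differences of `f` and of `g` between their terminals (`sum_mul_sum_eq_of_ties`). This is Abel
  summation in both directions; the remaining terms vanish because at every inner crossing exactly
  one of the two brick-wall patterns has a tie. Two potentials would make the left side zero and
  the right side nonzero.
* At most one of them conducts: the partial sums along the rows of a unit flow in the dual network
  form a potential of the first (`hammock_not_conducts_of_conducts`).

Summing over all `A` yields `h p + h⊥ (1 - p) = 1`, and the claim follows by comparing coefficients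
with `1 = (p + (1 - p)) ^ n`, since the coefficients of an N-form are unique. When `l` or `w` is
odd, a reflection exchanges the two patterns, so that the restriction `c' ≠ c` can be dropped.
-/

/-! ### Potentials, flows and reliability of two-terminal networks -/

namespace TwoTerminalNetwork

variable {V E V' E' : Type*}

theorem apply_eq_of_reachable {G : TwoTerminalNetwork V E} {A : Finset E} {α : Type*} {f : V → α}
    (hf : ∀ e ∈ A, f (G.src e) = f (G.tgt e)) {u v : V} (h : (G.closedGraph A).Reachable u v) :
    f u = f v := by
  obtain ⟨p⟩ := h
  induction p with
  | nil => rfl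
  | cons hadj _ ih =>
    rw [← ih]
    rw [closedGraph, SimpleGraph.fromRel_adj] at hadj
    obtain ⟨_, ⟨e, he, rfl, rfl⟩ | ⟨e, he, rfl, rfl⟩⟩ := hadj
    · exact hf e he
    · exact (hf e he).symm

theorem reachable_src_tgt (G : TwoTerminalNetwork V E) {A : Finset E} {e : E} (he : e ∈ A) :
    (G.closedGraph A).Reachable (G.src e) (G.tgt e) := by
  by_cases h : G.src e = G.tgt e
  · rw [h]
  · refine SimpleGraph.Adj.reachable ?_
    rw [closedGraph, SimpleGraph.fromRel_adj]
    exact ⟨h, Or.inl ⟨e, he, rfl, rfl⟩⟩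

/-- The terminals are disconnected exactly when a potential separates them. -/
theorem not_conducts_iff (G : TwoTerminalNetwork V E) (A : Finset E) :
    ¬ G.Conducts A ↔
      ∃ f : V → ℤ, (∀ e ∈ A, f (G.src e) = f (G.tgt e)) ∧ f G.s ≠ f G.t := by
  classical
  constructor
  · intro h
    refine ⟨fun v => if (G.closedGraph A).Reachable G.s v then 1 else 0, fun e he => ?_, ?_⟩
    · have := G.reachable_src_tgt he
      simp only [show (G.closedGraph A).Reachable G.s (G.src e) ↔
        (G.closedGraph A).Reachable G.s (G.tgt e) from
          ⟨fun h => h.trans this, fun h => h.trans this.symm⟩]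
    · have h' : ¬ (G.closedGraph A).Reachable G.s G.t := h
      simp [h']
  · rintro ⟨f, hf, hne⟩ h
    exact hne (apply_eq_of_reachable hf h)

/-- If the terminals are connected, a unit flow through the closed edges leads from one to the
other. The conservation law is stated in weak form, by testing against functions on the
vertices. -/
theorem Conducts.exists_flow [Fintype E] {G : TwoTerminalNetwork V E} {A : Finset E}
    (h : G.Conducts A) :
    ∃ D : E → ℤ, (∀ e ∉ A, D e = 0) ∧
      ∀ g : V → ℤ, ∑ e, D e * (g (G.tgt e) - g (G.src e)) = g G.t - g G.s := by
  classical
  obtain ⟨p⟩ : (G.closedGraph A).Reachable G.s G.t := h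
  generalize G.s = u, G.t = v at p
  induction p with
  | nil => exact ⟨0, by simp, by simp⟩
  | cons hadj _ ih =>
    obtain ⟨D, hD, hg⟩ := ih
    rw [closedGraph, SimpleGraph.fromRel_adj] at hadj
    obtain ⟨_, ⟨e, he, rfl, rfl⟩ | ⟨e, he, rfl, rfl⟩⟩ := hadj
    · refine ⟨D + Pi.single e 1, fun e' he' => ?_, fun g => ?_⟩
      · rw [Pi.add_apply, hD e' he', Pi.single_eq_of_ne (ne_of_mem_of_not_mem he he').symm,
          add_zero]
      · simp [add_mul, Finset.sum_add_distrib, hg, Pi.single_apply]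
    · refine ⟨D - Pi.single e 1, fun e' he' => ?_, fun g => ?_⟩
      · rw [Pi.sub_apply, hD e' he', Pi.single_eq_of_ne (ne_of_mem_of_not_mem he he').symm,
          sub_zero]
      · simp [sub_mul, Finset.sum_sub_distrib, hg, Pi.single_apply]

/-- A homomorphism of networks, which may reverse edges and exchange the terminals, preserves
connectedness of the terminals. -/
theorem Conducts.map {G : TwoTerminalNetwork V E} {G' : TwoTerminalNetwork V' E'}
    (φ : V → V') (σ : E ≃ E')
    (he : ∀ e, s(φ (G.src e), φ (G.tgt e)) = s(G'.src (σ e), G'.tgt (σ e)))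
    (hst : s(φ G.s, φ G.t) = s(G'.s, G'.t)) {A : Finset E} (h : G.Conducts A) :
    G'.Conducts (A.map σ.toEmbedding) := by
  contrapose! h
  rw [not_conducts_iff] at h ⊢
  obtain ⟨f, hf, hne⟩ := h
  refine ⟨f ∘ φ, fun e heA => ?_, ?_⟩
  · have h1 := hf (σ e) (by simpa using heA)
    rcases Sym2.eq_iff.1 (he e) with ⟨h2, h3⟩ | ⟨h2, h3⟩ <;> simp [h1, h2, h3]
  · rcases Sym2.eq_iff.1 hst with ⟨h2, h3⟩ | ⟨h2, h3⟩ <;> simp [h2, h3, hne, hne.symm]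

open Classical in
theorem reliability_congr [Fintype E] [Fintype E'] {G : TwoTerminalNetwork V E}
    {G' : TwoTerminalNetwork V' E'} (σ : E ≃ E')
    (h : ∀ A, G.Conducts A ↔ G'.Conducts (A.map σ.toEmbedding)) (p : ℝ) :
    G.reliability p = G'.reliability p := by
  unfold reliability
  refine Finset.sum_equiv σ.finsetCongr (fun A => by simp [h A]) fun A _ => ?_
  exact Fintype.prod_equiv σ _ _ fun e => by simp

/-- If the sets of contacts that fail to connect `G` correspond to the complements of those that
connect `G'`, then the reliability polynomials add up to one at complementary probabilities. -/
theorem reliability_add_reliability_one_sub [Fintype E] [inst : DecidableEq E] [Fintype E']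
    {G : TwoTerminalNetwork V E} {G' : TwoTerminalNetwork V' E'} (σ : E ≃ E')
    (h : ∀ A, G.Conducts A ↔ ¬ G'.Conducts (Aᶜ.map σ.toEmbedding)) (p : ℝ) :
    G.reliability p + G'.reliability (1 - p) = 1 := by
  -- The definition of `reliability` uses classical decidability.
  obtain rfl : inst = Classical.decEq E := Subsingleton.elim _ _
  classical
  have hG' : G'.reliability (1 - p) =
      ∑ A : Finset E with ¬ G.Conducts A, ∏ e : E, if e ∈ A then p else 1 - p := by
    unfold reliability
    symm
    refine Finset.sum_equiv ((compl_involutive (α := Finset E)).toPerm.trans σ.finsetCongr)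
      (fun A => by simp [h A]) fun A _ => ?_
    refine Fintype.prod_equiv σ _ _ fun e => ?_
    by_cases he : e ∈ A <;> simp [he]
  rw [hG', reliability, Finset.sum_filter_add_sum_filter_not]
  have := Finset.prod_add (fun _ : E => p) (fun _ => 1 - p) Finset.univ
  simp only [add_sub_cancel, Finset.prod_const_one, Finset.powerset_univ] at this
  refine Eq.trans (Finset.sum_congr rfl fun A _ => ?_) this.symm
  rw [Finset.prod_ite, Finset.filter_mem_eq_inter, Finset.univ_inter,
    Finset.filter_notMem_eq_sdiff]

end TwoTerminalNetwork

/-! ### Discrete integration by parts over the grid of contacts -/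

theorem sum_range_sub_mul_eq {R : Type*} [CommRing R] (a b : ℕ → R) (m : ℕ) :
    ∑ j ∈ Finset.range (m + 1), (a (j + 1) - a j) * b j =
      a (m + 1) * b m - a 0 * b 0 - ∑ j ∈ Finset.range m, a (j + 1) * (b (j + 1) - b j) := by
  induction m with
  | zero => simp; ring
  | succ m ih => rw [Finset.sum_range_succ, ih, Finset.sum_range_succ _ m]; ring

/-- Abel summation in both directions: the hypothesis `hfg` makes the remaining terms vanish. -/
theorem sum_range_sub_mul_sub_eq {R : Type*} [CommRing R] (f g : ℕ → ℕ → R) (l w : ℕ)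
    (fL fR gB gT : R) (hL : ∀ i ≤ w, f 0 i = fL) (hR : ∀ i ≤ w, f (l + 1) i = fR)
    (hB : ∀ j ≤ l, g 0 j = gB) (hT : ∀ j ≤ l, g (w + 1) j = gT)
    (hfg : ∀ j < l, ∀ i < w,
      f (j + 1) (i + 1) = f (j + 1) i ∨ g (i + 1) (j + 1) = g (i + 1) j) :
    ∑ j ∈ Finset.range (l + 1), ∑ i ∈ Finset.range (w + 1),
      (f (j + 1) i - f j i) * (g (i + 1) j - g i j) = (fR - fL) * (gT - gB) := by
  have inner : ∀ j < l, ∑ i ∈ Finset.range (w + 1), f (j + 1) i *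
      ((g (i + 1) (j + 1) - g i (j + 1)) - (g (i + 1) j - g i j)) = 0 := by
    intro j hj
    have h := sum_range_sub_mul_eq (fun i => g i (j + 1) - g i j) (fun i => f (j + 1) i) w
    have hz : ∑ i ∈ Finset.range w,
        (g (i + 1) (j + 1) - g (i + 1) j) * (f (j + 1) (i + 1) - f (j + 1) i) = 0 := by
      refine Finset.sum_eq_zero fun i hi => ?_
      rcases hfg j hj i (Finset.mem_range.1 hi) with h | h <;> simp [h]
    simp only [hz, hT j hj.le, hT (j + 1) hj, hB j hj.le, hB (j + 1) hj, sub_self, zero_mul] at h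
    rw [← h]
    exact Finset.sum_congr rfl fun i _ => by ring
  rw [Finset.sum_comm]
  simp_rw [fun i => sum_range_sub_mul_eq (fun j => f j i) (fun j => g (i + 1) j - g i j) l]
  rw [Finset.sum_sub_distrib, Finset.sum_comm (t := Finset.range l),
    Finset.sum_eq_zero fun j hj => inner j (Finset.mem_range.1 hj), sub_zero]
  have hb : ∀ i ∈ Finset.range (w + 1),
      f (l + 1) i * (g (i + 1) l - g i l) - f 0 i * (g (i + 1) 0 - g i 0) =
        fR * (g (i + 1) l - g i l) - fL * (g (i + 1) 0 - g i 0) := by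
    intro i hi
    have hi' : i ≤ w := Nat.lt_succ_iff.1 (Finset.mem_range.1 hi)
    rw [hL i hi', hR i hi']
  rw [Finset.sum_congr rfl hb, Finset.sum_sub_distrib, ← Finset.mul_sum, ← Finset.mul_sum,
    Finset.sum_range_sub (fun i => g i l), Finset.sum_range_sub (fun i => g i 0),
    hT l le_rfl, hB l le_rfl, hT 0 (Nat.zero_le _), hB 0 (Nat.zero_le _)]
  ring

/-! ### Duality of hammocks -/

/-- The pairing of functions on the vertices of two dual hammocks: the sum over all crossing pairs
of contacts depends only on the values at the terminals. -/
theorem sum_mul_sum_eq_of_ties {R : Type*} [CommRing R] {l w : ℕ} [NeZero l] [NeZero w]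
    {c c' : Fin 2} (hc : c' ≠ c) (f : HammockVertex l w c → R) (g : HammockVertex w l c' → R) :
    ∑ j : Fin l, ∑ i : Fin w,
      (f ((hammock l w c).tgt (j, i)) - f ((hammock l w c).src (j, i))) *
        (g ((hammock w l c').tgt (i, j)) - g ((hammock w l c').src (i, j))) =
      (f (hammock l w c).t - f (hammock l w c).s) *
        (g (hammock w l c').t - g (hammock w l c').s) := by
  obtain ⟨l, rfl⟩ := Nat.exists_eq_succ_of_ne_zero (NeZero.ne l)
  obtain ⟨w, rfl⟩ := Nat.exists_eq_succ_of_ne_zero (NeZero.ne w)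
  have key := sum_range_sub_mul_sub_eq
    (fun j i => f (Quot.mk _ (Fin.ofNat (l + 1 + 1) j, Fin.ofNat (w + 1) i)))
    (fun i j => g (Quot.mk _ (Fin.ofNat (w + 1 + 1) i, Fin.ofNat (l + 1) j))) l w
    (f (hammock (l + 1) (w + 1) c).s) (f (hammock (l + 1) (w + 1) c).t)
    (g (hammock (w + 1) (l + 1) c').s) (g (hammock (w + 1) (l + 1) c').t)
    (fun i _ => congrArg f (Quot.sound (HammockTie.left _ _)))
    (fun i _ => congrArg f (by
      rw [show Fin.ofNat (l + 1 + 1) (l + 1) = Fin.last (l + 1) from Fin.ext (by simp)]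
      exact Quot.sound (HammockTie.right _ _)))
    (fun i _ => congrArg g (Quot.sound (HammockTie.left _ _)))
    (fun i _ => congrArg g (by
      rw [show Fin.ofNat (w + 1 + 1) (w + 1) = Fin.last (w + 1) from Fin.ext (by simp)]
      exact Quot.sound (HammockTie.right _ _)))
    (fun j hj i hi => by
      have e1 : j % (l + 1) = j := Nat.mod_eq_of_lt (by omega)
      have e2 : (j + 1) % (l + 1) = j + 1 := Nat.mod_eq_of_lt (by omega)
      have e3 : (j + 1) % (l + 1 + 1) = j + 1 := Nat.mod_eq_of_lt (by omega)
      have e4 : i % (w + 1) = i := Nat.mod_eq_of_lt (by omega)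
      have e5 : (i + 1) % (w + 1) = i + 1 := Nat.mod_eq_of_lt (by omega)
      have e6 : (i + 1) % (w + 1 + 1) = i + 1 := Nat.mod_eq_of_lt (by omega)
      -- The two patterns have opposite parity, so one of them has a tie at this crossing.
      have hpar : (i + (j + 1)) % 2 = c ∨ (j + (i + 1)) % 2 = c' := by
        have := Fin.val_ne_iff.2 hc
        omega
      refine hpar.imp (fun h => congrArg f (Quot.sound ?_).symm)
        (fun h => congrArg g (Quot.sound ?_).symm)
      · exact HammockTie.brick _ _ _ (by simp [Fin.ofNat, e3]) (by simp [Fin.ofNat, e3, hj])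
          (by simp [Fin.ofNat, e4, e5]) (by simpa [Fin.ofNat, e3, e4] using h)
      · exact HammockTie.brick _ _ _ (by simp [Fin.ofNat, e6]) (by simp [Fin.ofNat, e6, hi])
          (by simp [Fin.ofNat, e1, e2]) (by simpa [Fin.ofNat, e6, e1] using h))
  rw [← key, ← Fin.sum_univ_eq_sum_range]
  refine Finset.sum_congr rfl fun j _ => ?_
  rw [← Fin.sum_univ_eq_sum_range]
  refine Finset.sum_congr rfl fun i _ => ?_
  have h1 : Fin.ofNat (l + 1 + 1) (j + 1) = j.succ := Fin.ext (by simp [Fin.ofNat]; omega)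
  have h2 : Fin.ofNat (l + 1 + 1) j = j.castSucc := Fin.ext (by simp [Fin.ofNat])
  have h3 : Fin.ofNat (w + 1 + 1) (i + 1) = i.succ := Fin.ext (by simp [Fin.ofNat]; omega)
  have h4 : Fin.ofNat (w + 1 + 1) i = i.castSucc := Fin.ext (by simp [Fin.ofNat])
  simp only [h1, h2, h3, h4, Fin.ofNat_val_eq_self]
  rfl

/-- A unit flow in the dual hammock integrates along the rows to a potential of the hammock. -/
theorem hammock_not_conducts_of_conducts {l w : ℕ} [NeZero l] [NeZero w] {c c' : Fin 2}
    (hc : c' ≠ c) {A : Finset (Fin l × Fin w)} {B : Finset (Fin w × Fin l)}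
    (hAB : ∀ j i, (j, i) ∈ A → (i, j) ∉ B) (hB : (hammock w l c').Conducts B) :
    ¬ (hammock l w c).Conducts A := by
  obtain ⟨D, hD, hflow⟩ := hB.exists_flow
  -- Conservation of the flow, tested against an indicator function on the junction points.
  have test : ∀ P : Fin (w + 1) × Fin l → Prop, ∀ [DecidablePred P],
      (∀ x y, HammockTie w l c' x y → (P x ↔ P y)) →
      ∑ i, ∑ j, D (i, j) * ((if P (i.succ, j) then 1 else 0) -
        (if P (i.castSucc, j) then 1 else 0)) =
        (if P (Fin.last w, 0) then 1 else 0) - (if P (0, 0) then 1 else 0) := by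
    intro P _ hP
    have := hflow (Quot.lift (fun x => if P x then 1 else 0) fun x y h => by simp only [hP x y h])
    rwa [Fintype.sum_prod_type] at this
  -- The flow through any row of contacts is one.
  have hone : ∀ i : Fin w, ∑ j, D (i, j) = 1 := by
    intro i
    have h := test (fun x => (i : ℕ) < x.1) (fun x y hxy => by cases hxy <;> rfl)
    rw [Finset.sum_eq_single i] at h
    · simpa using h
    · intro i' _ hi'
      have : ((i : ℕ) < (i' : ℕ) + 1) ↔ (i : ℕ) < i' := by
        have := Fin.val_ne_iff.2 hi'
        omega
      simp [this]
    · simp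
  rw [TwoTerminalNetwork.not_conducts_iff]
  refine ⟨Quot.lift (fun x => ∑ j : Fin l, if (j : ℕ) < x.1 then D (x.2, j) else 0) ?_, ?_, ?_⟩
  · intro x y hxy
    cases hxy with
    | left i i' => simp
    | right i i' => simp [hone]
    | brick j i i' hj hjl hi hpar =>
      -- The dual junction points between rows `i` and `i + 1` to the left of column `j` form a
      -- union of dual vertices, because the dual pattern has no tie across column `j`.
      have h := test (fun x => (x.1 : ℕ) = i' ∧ (x.2 : ℕ) < j) (fun x y hxy => by
        have hi'w := i'.isLt
        cases hxy with
        | left => simp [hi]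
        | right => simp; omega
        | brick a b b' ha haw hb hpar' =>
          have := Fin.val_ne_iff.2 hc
          simp only
          omega)
      have hi'w := i'.isLt
      have hr : (if ((Fin.last w : Fin (w + 1)) : ℕ) = i' ∧ ((0 : Fin l) : ℕ) < j then (1 : ℤ)
          else 0) = 0 := if_neg (by simp; omega)
      have hl : (if ((0 : Fin (w + 1)) : ℕ) = i' ∧ ((0 : Fin l) : ℕ) < j then (1 : ℤ)
          else 0) = 0 := if_neg (by simp; omega)
      simp only [hr, hl, sub_zero] at h
      rw [Finset.sum_comm] at h
      refine sub_eq_zero.1 (Eq.trans ?_ h)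
      rw [← Finset.sum_sub_distrib]
      refine Finset.sum_congr rfl fun k _ => ?_
      have hii' : i ≠ i' := fun h => by rw [h] at hi; omega
      simp only [mul_sub, Finset.sum_sub_distrib]
      rw [Finset.sum_eq_single i, Finset.sum_eq_single i']
      · simp [hi]
      · intro b _ hb
        have := Fin.val_ne_iff.2 hb
        simp [this]
      · simp
      · intro b _ hb
        have : (b : ℕ) ≠ i := Fin.val_ne_iff.2 hb
        have : ¬ ((b : ℕ) + 1 = i') := by omega
        simp [this]
      · simp
  · rintro ⟨j, i⟩ hji
    refine Finset.sum_congr rfl fun k _ => ?_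
    by_cases hk : k = j
    · subst hk
      simp [hD _ (hAB _ _ hji)]
    · have : ((k : ℕ) < (j : ℕ) + 1) ↔ (k : ℕ) < j := by
        have := Fin.val_ne_iff.2 hk
        omega
      simp [this]
  · simp [hammock, hone]

theorem hammock_conducts_iff_not_conducts {l w : ℕ} [NeZero l] [NeZero w] {c c' : Fin 2}
    (hc : c' ≠ c) (A : Finset (Fin l × Fin w)) :
    (hammock l w c).Conducts A ↔
      ¬ (hammock w l c').Conducts (Aᶜ.map (Equiv.prodComm _ _).toEmbedding) := by
  refine ⟨fun hA hB => hammock_not_conducts_of_conducts hc (fun j i h => ?_) hB hA, fun hB => ?_⟩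
  · simpa using h
  · by_contra hA
    rw [TwoTerminalNetwork.not_conducts_iff] at hA hB
    obtain ⟨f, hf, hfne⟩ := hA
    obtain ⟨g, hg, hgne⟩ := hB
    refine mul_ne_zero (sub_ne_zero.2 hfne.symm) (sub_ne_zero.2 hgne.symm) ?_
    rw [← sum_mul_sum_eq_of_ties hc]
    refine Finset.sum_eq_zero fun j _ => Finset.sum_eq_zero fun i _ => ?_
    by_cases h : (j, i) ∈ A
    · rw [hf _ h, sub_self, zero_mul]
    · rw [hg (i, j) (by simpa using h), sub_self, mul_zero]

/-! ### Reflections of hammocks -/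

/-- Reflecting the length turns pattern `c` into the other one when `l` is odd. -/
theorem hammock_conducts_revLength {l w : ℕ} [NeZero w] {c c' : Fin 2} (hl : Odd l) (hc : c' ≠ c)
    {A : Finset (Fin l × Fin w)} (h : (hammock l w c).Conducts A) :
    (hammock l w c').Conducts (A.map (Fin.revPerm.prodCongr (Equiv.refl _)).toEmbedding) := by
  refine h.map (Quot.map (fun x => (x.1.rev, x.2)) fun x y hxy => ?_) _ (fun e => ?_) ?_
  · cases hxy with
    | left i i' => simpa using HammockTie.right i i'
    | right i i' => simpa using HammockTie.left i i'
    | brick j i i' hj hjl hi hpar =>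
      refine HammockTie.brick _ _ _ ?_ ?_ hi ?_ <;> simp only [Fin.val_rev]
      · omega
      · omega
      · have := Fin.val_ne_iff.2 hc
        obtain ⟨m, rfl⟩ := hl
        omega
  · rw [Sym2.eq_swap]
    simp [hammock, Quot.map, Fin.rev_castSucc, Fin.rev_succ]
  · rw [Sym2.eq_swap]
    simp [hammock, Quot.map]

/-- Reflecting the width turns pattern `c` into the other one when `w` is odd. -/
theorem hammock_conducts_revWidth {l w : ℕ} [NeZero w] {c c' : Fin 2} (hw : Odd w) (hc : c' ≠ c)
    {A : Finset (Fin l × Fin w)} (h : (hammock l w c).Conducts A) :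
    (hammock l w c').Conducts (A.map ((Equiv.refl _).prodCongr Fin.revPerm).toEmbedding) := by
  let r : HammockVertex l w c → HammockVertex l w c' :=
    Quot.lift (fun x => Quot.mk _ (x.1, x.2.rev)) fun x y hxy => by
      cases hxy with
      | left i i' => exact Quot.sound (HammockTie.left _ _)
      | right i i' => exact Quot.sound (HammockTie.right _ _)
      | brick j i i' hj hjl hi hpar =>
        refine (Quot.sound (HammockTie.brick _ _ _ hj hjl ?_ ?_)).symm <;>
          simp only [Fin.val_rev]
        · omega
        · have := Fin.val_ne_iff.2 hc
          obtain ⟨m, rfl⟩ := hw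
          omega
  refine h.map r _ (fun e => rfl) ?_
  rw [show r (hammock l w c).s = (hammock l w c').s from Quot.sound (HammockTie.left _ _),
    show r (hammock l w c).t = (hammock l w c').t from Quot.sound (HammockTie.right _ _)]

theorem hammock_reliability_eq_of_odd {l w : ℕ} [NeZero w] (c c' : Fin 2) (h : Odd l ∨ Odd w)
    (p : ℝ) : (hammock l w c).reliability p = (hammock l w c').reliability p := by
  rcases eq_or_ne c' c with rfl | hc
  · rfl
  rcases h with h | h
  · refine TwoTerminalNetwork.reliability_congr _
      (fun A => ⟨hammock_conducts_revLength h hc, fun hA => ?_⟩) p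
    convert hammock_conducts_revLength h hc.symm hA
    ext ⟨j, i⟩; simp
  · refine TwoTerminalNetwork.reliability_congr _
      (fun A => ⟨hammock_conducts_revWidth h hc, fun hA => ?_⟩) p
    convert hammock_conducts_revWidth h hc.symm hA
    ext ⟨j, i⟩; simp

theorem hammock_reliability_add {l w : ℕ} [NeZero l] [NeZero w] {c c' : Fin 2}
    (hdual : Even l → Even w → c' ≠ c) (p : ℝ) :
    (hammock l w c).reliability p + (hammock w l c').reliability (1 - p) = 1 := by
  by_cases hc : c' = c
  · have hodd : Odd w ∨ Odd l := by
      by_contra! h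
      exact hdual (Nat.not_odd_iff_even.1 h.2) (Nat.not_odd_iff_even.1 h.1) hc
    rw [hammock_reliability_eq_of_odd c' (c + 1) hodd]
    have hc1 : c + 1 ≠ c := by clear hc hdual; revert c; decide
    exact TwoTerminalNetwork.reliability_add_reliability_one_sub (Equiv.prodComm _ _)
      (hammock_conducts_iff_not_conducts hc1) p
  · exact TwoTerminalNetwork.reliability_add_reliability_one_sub (Equiv.prodComm _ _)
      (hammock_conducts_iff_not_conducts hc) p

/-! ### Uniqueness of the N-form -/

theorem eq_zero_of_sum_pow_mul_one_sub_pow_eq_zero (n : ℕ) (a : ℕ → ℝ)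
    (h : ∀ p ∈ Set.Icc (0 : ℝ) 1,
      ∑ k ∈ Finset.range (n + 1), a k * p ^ k * (1 - p) ^ (n - k) = 0) :
    ∀ k ≤ n, a k = 0 := by
  -- Substituting `p = x / (1 + x)` turns the form into a polynomial in `x` divided by `(1 + x) ^ n`.
  have hroot : ∀ x : ℝ, 0 < x → ∑ k ∈ Finset.range (n + 1), a k * x ^ k = 0 := by
    intro x hx
    have h1 : (0 : ℝ) < 1 + x := by positivity
    have hp := h (x / (1 + x)) ⟨by positivity, (div_le_one h1).2 (by linarith)⟩
    have hx1 : 1 - x / (1 + x) = 1 / (1 + x) := by field_simp; ring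
    rw [hx1] at hp
    have hsum : ∑ k ∈ Finset.range (n + 1), a k * x ^ k = (1 + x) ^ n *
        ∑ k ∈ Finset.range (n + 1), a k * (x / (1 + x)) ^ k * (1 / (1 + x)) ^ (n - k) := by
      rw [Finset.mul_sum]
      refine Finset.sum_congr rfl fun k hk => ?_
      have hkn : k + (n - k) = n := by have := Finset.mem_range.1 hk; omega
      rw [div_pow, div_pow, one_pow]
      nth_rw 1 [← hkn]
      rw [pow_add]
      field_simp
    rw [hsum, hp, mul_zero]
  let Q : Polynomial ℝ :=
    ∑ k ∈ Finset.range (n + 1), Polynomial.C (a k) * Polynomial.X ^ k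
  have hQ : Q = 0 := by
    refine Polynomial.eq_zero_of_infinite_isRoot Q ((Set.Ioi_infinite (0 : ℝ)).mono fun x hx => ?_)
    simpa [Q, Polynomial.IsRoot, Polynomial.eval_finsetSum] using hroot x hx
  intro k hk
  have hcoeff := congrArg (fun P => Polynomial.coeff P k) hQ
  simpa [Q, Polynomial.finsetSum_coeff, Polynomial.coeff_C_mul, Polynomial.coeff_X_pow,
    Nat.lt_succ_iff, hk] using hcoeff

theorem mainTheorem2 (l w : ℕ) [NeZero l] [NeZero w] (c c' : Fin 2)
    (hdual : Even l → Even w → c' ≠ c)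
    (N Nperp : ℕ → ℝ)
    (hN : IsNForm (l * w) (hammock l w c).reliability N)
    (hNperp : IsNForm (l * w) (hammock w l c').reliability Nperp) :
    ∀ k ≤ l * w, N k + Nperp (l * w - k) = ((l * w).choose k : ℝ) := by
  intro k hk
  rw [← sub_eq_zero]
  refine eq_zero_of_sum_pow_mul_one_sub_pow_eq_zero (l * w)
    (fun k => N k + Nperp (l * w - k) - ((l * w).choose k : ℝ)) (fun p hp => ?_) k hk
  have hsum := hammock_reliability_add (c := c) hdual p
  rw [hN p hp, hNperp (1 - p) ⟨by linarith [hp.2], by linarith [hp.1]⟩,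
    ← Finset.sum_range_reflect (fun k => Nperp k * (1 - p) ^ k * (1 - (1 - p)) ^ (l * w - k)),
    sub_sub_cancel] at hsum
  have hbinom := add_pow p (1 - p) (l * w)
  rw [add_sub_cancel, one_pow] at hbinom
  replace hsum := hsum.trans hbinom
  rw [← sub_eq_zero, ← Finset.sum_add_distrib, ← Finset.sum_sub_distrib] at hsum
  rw [← hsum]
  refine Finset.sum_congr rfl fun m hm => ?_
  have hm' : l * w - (l * w - m) = m := by have := Finset.mem_range.1 hm; omega
  simp only [Nat.add_sub_cancel, hm']
  ring
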